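/- All graphs are finite, simple and undirected. For a connected graph $G$, an independent broadcast on $G$ is a function $f:V(G)\to\mathbb{N}_0$ such that $f(x)\le \mathrm{ecc}_G(x)$ for every vertex $x$, and $\mathrm{dist}_G(x,y)>\max\{f(x),f(y)\}$ for every two distinct vertices $x,y$ with $f(x),f(y)>0$. The broadcast independence number $\alpha_b(G)$ is the maximum weight $\sum_{x\in V(G)}f(x)$ of an independent broadcast $f$ on $G$; a broadcast attaining it is optimal. Let $\alpha(G)$ be the independence number of $G$. For a positive integer $k$, a graph $H$ is a $k$-strip with partition $(B_0,\ldots,B_k)$ if $V(H)$ is partitioned into nonempty cliques $B_0,\ldots,B_k$ such that $B_0$ contains a unique vertex $x$, all vertices in $B_i$ have distance $i$ in $H$ from $x$, and $B_i$ is completely joined to $B_{i+1}$ for every even $i$ with $0\le i\le k-1$. For an integer $k\ge 0$, let $\mathcal{G}_2(k)$ be the class of all connected graphs that arise from the disjoint union of two $(2k+1)$-strips, with partitions $(B^1_0,\ldots,B^1_{2k+1})$ and $(B^2_0,\ldots,B^2_{2k+1})$, by adding some edges between $B^1_{2k+1}$ and $B^2_{2k+1}$. For integers $k\ge1$ and $\ell\ge2$,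 let $\mathcal{G}_0(k,\ell)$ be the class of all graphs that arise from the disjoint union of $\ell$ $2k$-strips, with partitions $(B^i_0,\ldots,B^i_{2k})$ for $1\le i\le\ell$, and a possibly empty set $R$ of vertices by adding all possible edges within $R\cup\bigcup_{i=1}^{\ell}B^i_{2k}$. Let $\mathcal{G}_2=\bigcup_{k\ge0}\mathcal{G}_2(k)$ and $\mathcal{G}_0=\bigcup_{k\ge1}\bigcup_{\ell\ge2}\mathcal{G}_0(k,\ell)$. Theorem. Let $G$ be a connected graph such that $G$ has diameter at least $3$ or $\alpha(G)\ge3$, let $f$ be an optimal independent broadcast on $G$, and let $f_{\max}=\max\{f(x):x\in V(G)\}$. Then $$\alpha_b(G)\le 4\alpha(G)-4\min\left\{1,\frac{2\alpha(G)}{f_{\max}+2}\right\};$$ in particular, $\alpha_b(G)\le4\alpha(G)$. Equality holds in the displayed inequality if and only if $G\in\mathcal{G}_0\cup\mathcal{G}_2$. -/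

import Mathlib

/-- An independent broadcast on a (finite connected) graph `G`: every value is at most the
eccentricity of its vertex, and any two distinct vertices of positive value are at distance larger
than both of their values. -/
structure IsIndependentBroadcast {V : Type*} (G : SimpleGraph V) (f : V → ℕ) : Prop where
  le_eccent : ∀ x, (f x : ℕ∞) ≤ G.eccent x
  lt_dist : ∀ x y, x ≠ y → 0 < f x → 0 < f y → max (f x) (f y) < G.dist x y

/-- The broadcast independence number: the maximum weight of an independent broadcast (for a finite
connected graph the set of weights is nonempty and bounded, so the supremum is a maximum). -/
noncomputable def broadcastIndepNum {V : Type*} [Fintype V] (G : SimpleGraph V) : ℕ :=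
  sSup {w : ℕ | ∃ f : V → ℕ, IsIndependentBroadcast G f ∧ ∑ x, f x = w}

/-- An independent broadcast is optimal if its weight is the broadcast independence number. -/
def IsOptimalBroadcast {V : Type*} [Fintype V] (G : SimpleGraph V) (f : V → ℕ) : Prop :=
  IsIndependentBroadcast G f ∧ ∑ x, f x = broadcastIndepNum G

/-- `H` is a `k`-strip with partition `(B 0, …, B k)`: the `B i` are nonempty cliques that partition
the vertex set, `B 0` consists of a single vertex `x`, all vertices of `B i` have distance `i` in `H`
from `x`, and `B i` is completely joined to `B (i + 1)` for every even `i` with `i + 1 ≤ k`. -/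
structure IsStrip {W : Type*} (H : SimpleGraph W) (k : ℕ) (B : Fin (k + 1) → Set W) : Prop where
  nonempty : ∀ i, (B i).Nonempty
  partition : ∀ w, ∃! i, w ∈ B i
  isClique : ∀ i, H.IsClique (B i)
  dist_root : ∃ x, B 0 = {x} ∧ ∀ i, ∀ y ∈ B i, H.dist x y = (i : ℕ)
  joined : ∀ i j : Fin (k + 1), Even (i : ℕ) → (j : ℕ) = (i : ℕ) + 1 →
    ∀ u ∈ B i, ∀ v ∈ B j, H.Adj u v

/-- `G` arises from the disjoint union of two `(2k+1)`-strips by adding edges between their last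
cliques, and is connected. The two strips are the subgraphs of `G` induced by the complementary
sets `S₁` and `S₂`. -/
def IsGluedPair {V : Type*} (G : SimpleGraph V) (k : ℕ) : Prop :=
  G.Connected ∧
  ∃ (S₁ S₂ : Set V) (B₁ : Fin (2 * k + 1 + 1) → Set S₁) (B₂ : Fin (2 * k + 1 + 1) → Set S₂),
    IsCompl S₁ S₂ ∧
    IsStrip (G.induce S₁) (2 * k + 1) B₁ ∧
    IsStrip (G.induce S₂) (2 * k + 1) B₂ ∧
    ∀ (u : S₁) (v : S₂), G.Adj u v → u ∈ B₁ (Fin.last _) ∧ v ∈ B₂ (Fin.last _)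

/-- `G` arises from the disjoint union of `ℓ` many `2k`-strips and a possibly empty set `R` of
vertices by adding all possible edges within the union `hub` of `R` and the last cliques of the
strips. The strips are the subgraphs of `G` induced by the pairwise disjoint sets `S i` (their last
sets are cliques already, so the added edges do not change these induced subgraphs), and `R` is the
set of all remaining vertices. -/
def IsGluedStar {V : Type*} (G : SimpleGraph V) (k ℓ : ℕ) : Prop :=
  ∃ (S : Fin ℓ → Set V) (B : (i : Fin ℓ) → Fin (2 * k + 1) → Set (S i)) (R hub : Set V),
    Pairwise (fun i j => Disjoint (S i) (S j)) ∧
    R = (⋃ i, S i)ᶜ ∧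
    hub = R ∪ ⋃ i, Subtype.val '' B i (Fin.last _) ∧
    (∀ i, IsStrip (G.induce (S i)) (2 * k) (B i)) ∧
    G.IsClique hub ∧
    ∀ u v, G.Adj u v → (∃ i, u ∈ S i ∧ v ∈ S i) ∨ (u ∈ hub ∧ v ∈ hub)

/-- The family `𝒢₂`. The index `k = 0` (two cliques glued together) belongs to it. -/
def MemG2 {V : Type*} (G : SimpleGraph V) : Prop :=
  ∃ k : ℕ, IsGluedPair G k

/-- The family `𝒢₀`. -/
def MemG0 {V : Type*} (G : SimpleGraph V) : Prop :=
  ∃ k ℓ : ℕ, 1 ≤ k ∧ 2 ≤ ℓ ∧ IsGluedStar G k ℓ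

/-! Let `X` be the support of a broadcast `f` and suppose it has at least two vertices. On a
geodesic leaving `x`, every second vertex up to distance `2 * ((f x - 1) / 4)` gives `⌈f x / 4⌉`
independent vertices. The inequality `dist x y > max (f x) (f y)` keeps the packings around
different centres at distance at least 2, so `∑ ⌈f x / 4⌉ ≤ α`. Some `w` with `f w` congruent to 0
or 3 mod 4 leaves room for one more vertex, and then `∑ f + 4 ≤ 4α`. Without such a `w`, every
rounding loses at least 2, and two centres again lose 4. Since values in `X` are below distances,
which are at most `2α - 1`, the minimum in the bound is 1. If `X` has at most one vertex, the weight
is at most `2α - 1` and the bound is strict.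

Equality leaves two cases: all values are `4k` with centres pairwise at distance `4k + 1` and `α =
k|X| + 1`, or two centres have value `4k + 2` and distance `4k + 3` with `α = 2k + 2`. Any edge
missing from the strips or the hub would then permit a larger independent set
(`isGluedStar_of_dist_eq`, `isGluedPair_of_dist_eq`). Conversely, a clique cover bounds `α` above,
and constant values on the strip roots give a broadcast of weight at least `4α - 4`. -/

namespace SimpleGraph

/-! ### Independent sets built from distance layers. -/

section Packing

variable {V : Type*} {G : SimpleGraph V}

/-- A vertex at each intermediate distance on a geodesic. -/
theorem Connected.exists_dist_eq_of_le (hG : G.Connected) {x y : V} {i : ℕ}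
    (hi : i ≤ G.dist x y) : ∃ z, G.dist x z = i ∧ G.dist z y = G.dist x y - i := by
  obtain ⟨p, hp⟩ := hG.exists_walk_length_eq_dist x y
  refine ⟨p.getVert i, ?_⟩
  have h1 := dist_le (p.take i)
  have h2 := dist_le (p.drop i)
  have h3 := hG.dist_triangle (u := x) (v := p.getVert i) (w := y)
  rw [Walk.take_length] at h1
  rw [Walk.drop_length] at h2
  omega

theorem Connected.exists_le_dist_of_le_eccent [Finite V] (hG : G.Connected) {x : V} {n : ℕ}
    (h : (n : ℕ∞) ≤ G.eccent x) : ∃ z, n ≤ G.dist x z := by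
  have := hG.nonempty
  obtain ⟨z, hz⟩ := G.exists_edist_eq_eccent_of_finite x
  refine ⟨z, ?_⟩
  rw [← hz, ← (hG x z).coe_dist_eq_edist] at h
  exact_mod_cast h

theorem natCast_le_eccent_of_le_dist {x z : V} {n : ℕ} (h : n ≤ G.dist x z) :
    (n : ℕ∞) ≤ G.eccent x := by
  refine le_trans ?_ (edist_le_eccent (v := z))
  refine le_trans (Nat.cast_le.2 h) ?_
  exact ENat.natCast_toNat_le_self _

theorem ne_and_not_adj_of_two_le_dist {u v : V} (h : 2 ≤ G.dist u v) : u ≠ v ∧ ¬ G.Adj u v := by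
  constructor
  · rintro rfl
    simp at h
  · intro hadj
    rw [dist_eq_one_iff_adj.2 hadj] at h
    omega

/-- There is an independent set of `n` vertices at distance at most `r` from `x`. -/
def HasPacking (G : SimpleGraph V) (x : V) (r n : ℕ) : Prop :=
  ∃ T : Finset V, G.IsIndepSet T ∧ (∀ t ∈ T, G.dist x t ≤ r) ∧ T.card = n

theorem HasPacking.mono {x : V} {r r' n : ℕ} (h : G.HasPacking x r n) (hr : r ≤ r') :
    G.HasPacking x r' n := by
  obtain ⟨T, h1, h2, h3⟩ := h
  exact ⟨T, h1, fun t ht => (h2 t ht).trans hr, h3⟩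

theorem IsIndepSet.union_of_two_le_dist [DecidableEq V] {A C : Finset V} (hA : G.IsIndepSet A)
    (hC : G.IsIndepSet C) (h : ∀ a ∈ A, ∀ c ∈ C, 2 ≤ G.dist a c) :
    G.IsIndepSet (A ∪ C : Finset V) ∧ (A ∪ C).card = A.card + C.card := by
  constructor
  · intro u hu v hv huv
    simp only [Finset.coe_union, Set.mem_union, Finset.mem_coe] at hu hv
    rcases hu with hu | hu <;> rcases hv with hv | hv
    · exact hA hu hv huv
    · exact (ne_and_not_adj_of_two_le_dist (h u hu v hv)).2
    · exact fun hadj => (ne_and_not_adj_of_two_le_dist (h v hv u hu)).2 hadj.symm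
    · exact hC hu hv huv
  · apply Finset.card_union_of_disjoint
    rw [Finset.disjoint_left]
    intro a ha ha'
    exact (ne_and_not_adj_of_two_le_dist (h a ha a ha')).1 rfl

theorem HasPacking.union (hG : G.Connected) {x : V} {a b n : ℕ} (h : G.HasPacking x a n)
    (hab : a ≤ b) {C : Finset V} (hC : G.IsIndepSet C)
    (hCx : ∀ c ∈ C, a + 2 ≤ G.dist x c ∧ G.dist x c ≤ b) : G.HasPacking x b (n + C.card) := by
  classical
  obtain ⟨T, h1, h2, rfl⟩ := h
  have key := h1.union_of_two_le_dist hC (fun t ht c hc => by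
    have := h2 t ht
    have := hCx c hc
    have := hG.dist_triangle (u := x) (v := t) (w := c)
    omega)
  refine ⟨T ∪ C, key.1, ?_, key.2⟩
  intro t ht
  rcases Finset.mem_union.1 ht with ht | ht
  · exact (h2 t ht).trans hab
  · exact (hCx t ht).2

/-- Each further pair of layers contributes one vertex, found on a geodesic to `z`. -/
theorem HasPacking.extend (hG : G.Connected) {x z : V} {r n : ℕ} (h : G.HasPacking x r n)
    (k : ℕ) (hz : r + 2 * k ≤ G.dist x z) : G.HasPacking x (r + 2 * k) (n + k) := by
  induction k with
  | zero => simpa using h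
  | succ k ih =>
    obtain ⟨w, hw, -⟩ := hG.exists_dist_eq_of_le hz
    have := (ih (by omega)).union hG (b := r + 2 * (k + 1)) (by omega) (C := {w}) (by simp)
      (by simp; omega)
    simpa [add_assoc] using this

theorem hasPacking_zero (G : SimpleGraph V) (x : V) : G.HasPacking x 0 1 :=
  ⟨{x}, by simp, by simp, by simp⟩

theorem Connected.hasPacking (hG : G.Connected) {x z : V} {r : ℕ} (hz : r ≤ G.dist x z) :
    G.HasPacking x r (r / 2 + 1) := by
  have := (G.hasPacking_zero x).extend hG (r / 2) (z := z) (by omega)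
  rw [add_comm 1] at this
  exact this.mono (by omega)

/-- A missing edge in a layer, or between an even layer and the next one, yields one more vertex
than alternate layers do. -/
theorem Connected.hasPacking_of_not_adj (hG : G.Connected) {x z u v : V} {r : ℕ}
    (hz : r ≤ G.dist x z) (huv : u ≠ v) (hadj : ¬ G.Adj u v)
    (hlayer : G.dist x v = G.dist x u ∨ Even (G.dist x u) ∧ G.dist x v = G.dist x u + 1)
    (hr : G.dist x v ≤ r) (hpar : Even (r - G.dist x v)) : G.HasPacking x r (r / 2 + 2) := by
  classical
  have hpair : G.IsIndepSet ({u, v} : Finset V) := by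
    simp only [Finset.coe_insert, Finset.coe_singleton]
    intro a ha b hb hab
    simp only [Set.mem_insert_iff, Set.mem_singleton_iff] at ha hb
    rcases ha with rfl | rfl <;> rcases hb with rfl | rfl <;>
      first | exact absurd rfl hab | exact hadj | exact fun h => hadj h.symm
  have hcard : ({u, v} : Finset V).card = 2 := Finset.card_pair huv
  -- The pair `u`, `v` replaces the single vertex that alternate layers would supply here; a packing
  -- of radius `dist x u - 2` fits below it.
  have hbase : G.HasPacking x (G.dist x v) (G.dist x u / 2 + 2) := by
    by_cases hi : 2 ≤ G.dist x u
    · have := (hG.hasPacking (x := x) (z := z) (r := G.dist x u - 2) (by omega)).union hG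
        (b := G.dist x v) (by omega) hpair (by simp; omega)
      rw [hcard] at this
      convert this using 1
      omega
    · refine ⟨{u, v}, hpair, ?_, ?_⟩
      · simp; omega
      · omega
  obtain ⟨c, hc⟩ := hpar
  have := hbase.extend hG c (z := z) (by omega)
  have e1 : G.dist x v + 2 * c = r := by omega
  rw [e1] at this
  convert this using 1
  -- If `v` lies one layer above `u`, evenness of `dist x u` ensures that the two layers have the
  -- same half, so nothing is lost in `r / 2`.
  rcases hlayer with h | ⟨⟨d, hd⟩, h⟩ <;> omega

/-- The balls around the centres are at mutual distance at least 2, and at distance at least 2 from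
`E`, so the packings and `E` merge into one independent set. -/
theorem Connected.sum_packing_add_card_le [Finite V] (hG : G.Connected) (X E : Finset V)
    (r n : V → ℕ) (hE : G.IsIndepSet E) (hXE : ∀ x ∈ X, ∀ e ∈ E, r x + 2 ≤ G.dist x e)
    (hP : ∀ x ∈ X, G.HasPacking x (r x) (n x))
    (hX : ∀ x ∈ X, ∀ y ∈ X, x ≠ y → r x + r y + 2 ≤ G.dist x y) :
    ∑ x ∈ X, n x + E.card ≤ G.indepNum := by
  classical
  choose! T h1 h2 h3 using hP
  have hfar : ∀ x ∈ X, ∀ y ∈ X, x ≠ y → ∀ a ∈ T x, ∀ b ∈ T y, 2 ≤ G.dist a b := by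
    intro x hx y hy hxy a ha b hb
    have := h2 x hx a ha
    have := h2 y hy b hb
    have := hX x hx y hy hxy
    have := hG.dist_triangle (u := x) (v := a) (w := y)
    have := hG.dist_triangle (u := a) (v := b) (w := y)
    have := G.dist_comm (u := b) (v := y)
    omega
  have hU : G.IsIndepSet (X.biUnion T : Finset V) := by
    intro a ha b hb hab
    simp only [Finset.coe_biUnion, Set.mem_iUnion, Finset.mem_coe] at ha hb
    obtain ⟨x, hx, ha⟩ := ha
    obtain ⟨y, hy, hb⟩ := hb
    by_cases hxy : x = y
    · subst hxy
      exact h1 x hx ha hb hab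
    · exact (ne_and_not_adj_of_two_le_dist (hfar x hx y hy hxy a ha b hb)).2
  have hcard : (X.biUnion T).card = ∑ x ∈ X, n x := by
    rw [Finset.card_biUnion]
    · exact Finset.sum_congr rfl h3
    · intro x hx y hy hxy
      rw [Function.onFun, Finset.disjoint_left]
      intro a ha ha'
      exact (ne_and_not_adj_of_two_le_dist (hfar x hx y hy hxy a ha a ha')).1 rfl
  have key := hU.union_of_two_le_dist hE (fun a ha e he => by
    obtain ⟨x, hx, ha⟩ := Finset.mem_biUnion.1 ha
    have := h2 x hx a ha
    have := hXE x hx e he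
    have := hG.dist_triangle (u := x) (v := a) (w := e)
    omega)
  rw [← hcard, ← key.2]
  exact key.1.card_le_indepNum

theorem Connected.dist_add_one_le_two_mul_indepNum [Finite V] (hG : G.Connected) (x y : V) :
    G.dist x y + 1 ≤ 2 * G.indepNum := by
  obtain ⟨T, h1, -, h3⟩ := hG.hasPacking (le_refl (G.dist x y))
  have := h1.card_le_indepNum
  omega

end Packing

/-! ### The upper bound for supports with at least two vertices. -/

section Bound

variable {V : Type*} [Fintype V] {G : SimpleGraph V}

/-- Pack around each vertex of positive value up to about half its value. Vertices whose value is
congruent to `0` or `3` modulo `4` contribute one additional vertex, as long as no two of those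
used in this way are too close. -/
theorem Connected.sum_div_add_le_of_isIndependentBroadcast (hG : G.Connected) {f : V → ℕ}
    (hf : IsIndependentBroadcast G f) (p : V → Prop) [DecidablePred p]
    (hp : ∀ x y, p x → p y → x ≠ y →
      2 * ((f x - 1) / 4 + 1) + 2 * ((f y - 1) / 4 + 1) + 2 ≤ G.dist x y) (hmod : ∀ x, p x → f x % 4 = 0 ∨ f x % 4 = 3)
    (X : Finset V) (hX : ∀ x ∈ X, 0 < f x) :
    ∑ x ∈ X, ((f x - 1) / 4 + 1 + if p x then 1 else 0) ≤ G.indepNum := by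
  have := hG.sum_packing_add_card_le X ∅ (fun x => 2 * ((f x - 1) / 4 + if p x then 1 else 0))
    (fun x => (f x - 1) / 4 + 1 + if p x then 1 else 0) (by simp) (by simp) ?_ ?_
  · simpa using this
  · intro x hx
    have hx := hX x hx
    obtain ⟨z, hz⟩ := hG.exists_le_dist_of_le_eccent (hf.le_eccent x)
    have hr : 2 * ((f x - 1) / 4 + if p x then 1 else 0) ≤ G.dist x z := by
      split_ifs with h
      · have := hmod x h
        omega
      · omega
    have := hG.hasPacking hr
    convert this using 1
    omega
  · intro x hx y hy hxy
    have hx := hX x hx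
    have hy := hX y hy
    have hd := hf.lt_dist x y hxy hx hy
    have h1 := le_max_left (f x) (f y)
    have h2 := le_max_right (f x) (f y)
    split_ifs with h h' h'
    · exact hp x y h h' hxy
    · have := hmod x h
      omega
    · have := hmod y h'
      omega
    · omega

theorem Connected.sum_add_four_le_of_isIndependentBroadcast (hG : G.Connected) {f : V → ℕ}
    (hf : IsIndependentBroadcast G f) (X : Finset V) (hX : ∀ x ∈ X, 0 < f x) (hcard : 2 ≤ X.card) :
    ∑ x ∈ X, f x + 4 ≤ 4 * G.indepNum ∧
      (∑ x ∈ X, f x + 4 = 4 * G.indepNum →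
        (∀ x ∈ X, f x % 4 = 0) ∨ (X.card = 2 ∧ ∀ x ∈ X, f x % 4 = 2)) := by
  classical
  by_cases hw : ∃ w ∈ X, f w % 4 = 0 ∨ f w % 4 = 3
  · obtain ⟨w, hwX, hw⟩ := hw
    -- The one extra vertex gained at `w` accounts for the 4; equality then allows no rounding loss
    -- at all.
    have h1 := hG.sum_div_add_le_of_isIndependentBroadcast hf (fun x => x = w)
      (fun x y hx hy hxy => absurd (hx.trans hy.symm) hxy) (fun x hx => by rwa [hx]) X hX
    rw [Finset.sum_add_distrib, Finset.sum_ite_eq' X w, if_pos hwX] at h1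
    have h2 : ∀ x ∈ X, f x ≤ 4 * ((f x - 1) / 4 + 1) := fun x hx => by omega
    have h3 := Finset.sum_le_sum h2
    rw [← Finset.mul_sum] at h3
    refine ⟨by omega, fun heq => Or.inl ?_⟩
    by_contra! hne
    obtain ⟨x, hx, hxm⟩ := hne
    have h4 := Finset.sum_lt_sum h2 ⟨x, hx, by omega⟩
    rw [← Finset.mul_sum] at h4
    omega
  · push Not at hw
    have h1 := hG.sum_div_add_le_of_isIndependentBroadcast hf (fun _ => False)
      (fun x y hx => hx.elim) (fun x hx => hx.elim) X hX
    simp only [if_false, add_zero] at h1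
    -- Only residues 1 and 2 remain. The loss is 3 or 2 per vertex, so a total loss of exactly 4
    -- means two vertices of residue 2.
    have h2 : ∀ x ∈ X, f x + 2 ≤ 4 * ((f x - 1) / 4 + 1) := fun x hx => by
      have := hw x hx
      have := hX x hx
      omega
    have h3 := Finset.sum_le_sum h2
    rw [← Finset.mul_sum, Finset.sum_add_distrib, Finset.sum_const, smul_eq_mul] at h3
    refine ⟨by omega, fun heq => Or.inr ⟨by omega, ?_⟩⟩
    by_contra! hne
    obtain ⟨x, hx, hxm⟩ := hne
    have h4 := Finset.sum_lt_sum h2 ⟨x, hx, by have := hw x hx; omega⟩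
    rw [← Finset.mul_sum, Finset.sum_add_distrib, Finset.sum_const, smul_eq_mul] at h4
    omega

end Bound

/-! ### Balls as strips. -/

section Strip

variable {V : Type*} {G : SimpleGraph V}

/-- A geodesic from the centre to a vertex of the ball never leaves the ball. -/
theorem Connected.dist_induce_ball (hG : G.Connected) (x : V) (r : ℕ)
    (hx : x ∈ {v | G.dist x v ≤ r}) (y : {v | G.dist x v ≤ r}) :
    (G.induce {v | G.dist x v ≤ r}).dist ⟨x, hx⟩ y = G.dist x y := by
  have key : ∀ n, ∀ y : {v | G.dist x v ≤ r}, G.dist x y = n →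
      ∃ p : (G.induce {v | G.dist x v ≤ r}).Walk ⟨x, hx⟩ y, p.length = n := by
    intro n
    induction n with
    | zero =>
      intro y hy
      have : (⟨x, hx⟩ : {v | G.dist x v ≤ r}) = y := Subtype.ext (hG.dist_eq_zero_iff.1 hy)
      subst this
      exact ⟨Walk.nil, rfl⟩
    | succ n ih =>
      intro y hy
      obtain ⟨z, hz, hzy⟩ := hG.exists_dist_eq_of_le (x := x) (y := y) (i := n) (by omega)
      have hyr : G.dist x y ≤ r := y.2
      have hz' : G.dist x z ≤ r := by omega
      obtain ⟨p, hp⟩ := ih ⟨z, hz'⟩ hz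
      have hadj : (G.induce {v | G.dist x v ≤ r}).Adj ⟨z, hz'⟩ y := by
        rw [comap_adj]
        exact dist_eq_one_iff_adj.1 (by change G.dist z y = 1; omega)
      exact ⟨p.concat hadj, by simp [hp]⟩
  obtain ⟨p, hp⟩ := key _ y rfl
  refine le_antisymm (hp ▸ dist_le p) ?_
  obtain ⟨q, hq⟩ := p.reachable.exists_walk_length_eq_dist
  rw [← hq]
  have := dist_le (q.map (Embedding.induce {v | G.dist x v ≤ r}).toHom)
  rw [Walk.length_map] at this
  exact this

/-- A ball whose layers are cliques, with even layers completely joined to the next ones, induces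
a strip. -/
theorem Connected.isStrip_induce_ball (hG : G.Connected) {x z : V} {r : ℕ}
    (hz : r ≤ G.dist x z)
    (hadj : ∀ u v, u ≠ v → G.dist x v ≤ r →
      (G.dist x v = G.dist x u ∨ Even (G.dist x u) ∧ G.dist x v = G.dist x u + 1) → G.Adj u v) :
    IsStrip (G.induce {v | G.dist x v ≤ r}) r (fun i => {w | G.dist x w = i}) where
  nonempty i := by
    obtain ⟨w, hw, -⟩ := hG.exists_dist_eq_of_le (x := x) (y := z) (i := i) (by omega)
    exact ⟨⟨w, by simp; omega⟩, hw⟩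
  partition w := by
    have hw : G.dist x w ≤ r := w.2
    exact ⟨⟨G.dist x w, by omega⟩, rfl, fun i hi => Fin.ext hi.symm⟩
  isClique i := by
    intro u hu v hv huv
    rw [comap_adj]
    refine hadj _ _ (fun h => huv (Subtype.ext h)) v.2 (Or.inl ?_)
    exact hv.trans hu.symm
  dist_root := by
    refine ⟨⟨x, by simp⟩, ?_, fun i y hy => ?_⟩
    · ext w
      simp only [Set.mem_ofPred_eq, Set.mem_singleton_iff, Fin.val_zero, hG.dist_eq_zero_iff]
      exact ⟨fun h => Subtype.ext h.symm, fun h => (congrArg Subtype.val h).symm⟩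
    · rw [hG.dist_induce_ball]
      exact hy
  joined i j hi hj u hu v hv := by
    have hu' : G.dist x u = i := hu
    have hv' : G.dist x v = j := hv
    rw [comap_adj]
    refine hadj _ _ (fun h => ?_) v.2 (Or.inr ⟨hu' ▸ hi, by
      change G.dist x v = G.dist x u + 1; omega⟩)
    change (u : V) = v at h
    rw [h] at hu'
    omega

end Strip

/-! ### Tight distances and independence number force the structure. -/

section Extremal

variable {V : Type*} [Finite V] {G : SimpleGraph V}

/-- There is no slack: packings of `k + 1` vertices around `x` and `y` already reach the bound on
`α`. The two strips are the balls of radius `2k + 1`. -/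
theorem Connected.isGluedPair_of_dist_eq (hG : G.Connected) {x y : V} {k : ℕ}
    (hxy : G.dist x y = 4 * k + 3) (hα : G.indepNum ≤ 2 * k + 2) : IsGluedPair G k := by
  classical
  have hbound : ∀ x y : V, G.dist x y = 4 * k + 3 → ∀ n a, ∀ E : Finset V, G.IsIndepSet E →
      (∀ e ∈ E, a + 2 ≤ G.dist x e ∧ 2 * k + 2 ≤ G.dist y e) → a ≤ 2 * k + 1 →
      G.HasPacking x a n → n + E.card ≤ k + 1 := by
    intro x y hxy n a E hE hEd ha hn
    have hne : x ≠ y := by rintro rfl; simp at hxy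
    have hy : G.HasPacking y (2 * k) (k + 1) := by
      have := hG.hasPacking (x := y) (z := x) (r := 2 * k) (by rw [dist_comm]; omega)
      simpa using this
    have := hG.sum_packing_add_card_le {x, y} E (fun v => if v = x then a else 2 * k)
      (fun v => if v = x then n else k + 1) hE ?_ ?_ ?_
    · rw [Finset.sum_pair hne, if_pos rfl, if_neg hne.symm] at this
      omega
    · simp only [Finset.mem_insert, Finset.mem_singleton]
      rintro v (rfl | rfl) e he
      · simpa using (hEd e he).1
      · simpa [hne.symm] using (hEd e he).2
    · simp only [Finset.mem_insert, Finset.mem_singleton]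
      rintro v (rfl | rfl)
      · simpa using hn
      · simpa [hne.symm] using hy
    · simp only [Finset.mem_insert, Finset.mem_singleton]
      rintro v (rfl | rfl) w (rfl | rfl) hvw
      · exact absurd rfl hvw
      · simp [hne.symm]; omega
      · simp [hne.symm, G.dist_comm (u := v) (v := w)]; omega
      · exact absurd rfl hvw
  have hstrip : ∀ x y : V, G.dist x y = 4 * k + 3 →
      IsStrip (G.induce {v | G.dist x v ≤ 2 * k + 1}) (2 * k + 1)
        (fun i => {w | G.dist x w = i}) := by
    intro x y hxy
    refine hG.isStrip_induce_ball (z := y) (by omega) ?_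
    intro u v huv hv hl
    by_contra hadj
    rcases Nat.even_or_odd (2 * k + 1 - G.dist x v) with hpar | hpar
    · have := hbound x y hxy _ (2 * k + 1) ∅ (by simp) (by simp) le_rfl
        (hG.hasPacking_of_not_adj (z := y) (by omega) huv hadj hl hv hpar)
      simp at this
      omega
    · obtain ⟨c, hc⟩ := hpar
      have := hbound x y hxy _ (2 * k) ∅ (by simp) (by simp) (by omega)
        (hG.hasPacking_of_not_adj (z := y) (r := 2 * k) (by omega) huv hadj hl (by omega)
          ⟨c, by omega⟩)
      simp at this
  have hyx : G.dist y x = 4 * k + 3 := by rw [dist_comm, hxy]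
  have hcover : ∀ v, G.dist x v ≤ 2 * k + 1 ∨ G.dist y v ≤ 2 * k + 1 := by
    intro v
    by_contra! hv
    have := hbound x y hxy _ (2 * k) {v} (by simp) (by simp; omega) (by omega)
      (hG.hasPacking (z := y) (by omega))
    simp at this
  have htri : ∀ u v, 4 * k + 3 ≤ G.dist x u + G.dist u v + G.dist y v := by
    intro u v
    have := hG.dist_triangle (u := x) (v := u) (w := y)
    have := hG.dist_triangle (u := u) (v := v) (w := y)
    have := G.dist_comm (u := v) (v := y)
    omega
  refine ⟨hG, _, _, _, _, ?_, hstrip x y hxy, hstrip y x hyx, ?_⟩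
  · rw [isCompl_iff, Set.disjoint_left, codisjoint_iff]
    refine ⟨fun v hv hv' => ?_, Set.eq_univ_of_forall hcover⟩
    have := htri v v
    simp at this hv hv'
    omega
  · intro u v huv
    have hu : G.dist x u ≤ 2 * k + 1 := u.2
    have hv : G.dist y v ≤ 2 * k + 1 := v.2
    have := htri u v
    rw [dist_eq_one_iff_adj.2 huv] at this
    constructor
    · change G.dist x u = 2 * k + 1
      omega
    · change G.dist y v = 2 * k + 1
      omega

/-- Packings of `k` vertices within radius `2k - 2` of every centre leave a slack of one vertex, so
every missing edge has to yield two extra vertices. The strips are the balls of radius `2k`. -/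
theorem Connected.isGluedStar_of_dist_eq (hG : G.Connected) {X : Finset V} {k : ℕ} (hk : 1 ≤ k)
    (hcard : 2 ≤ X.card) (hX : ∀ x ∈ X, ∀ y ∈ X, x ≠ y → G.dist x y = 4 * k + 1)
    (hα : G.indepNum ≤ k * X.card + 1) : IsGluedStar G k X.card := by
  classical
  have hother : ∀ x ∈ X, ∃ y ∈ X, y ≠ x := fun x _ =>
    Finset.exists_mem_ne (by omega) x
  have hbase : ∀ x ∈ X, G.HasPacking x (2 * k - 2) k := by
    intro x hx
    obtain ⟨y, hy, hyx⟩ := hother x hx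
    have := hX x hx y hy hyx.symm
    have := hG.hasPacking (x := x) (z := y) (r := 2 * k - 2) (by omega)
    convert this using 1
    omega
  have hbound : ∀ x ∈ X, ∀ n a, ∀ E : Finset V, G.IsIndepSet E →
      (∀ e ∈ E, a + 2 ≤ G.dist x e ∧ ∀ y ∈ X, y ≠ x → 2 * k ≤ G.dist y e) → a ≤ 2 * k →
      G.HasPacking x a (k + n) → n + E.card ≤ 1 := by
    intro x hx n a E hE hEd ha hn
    have := hG.sum_packing_add_card_le X E (fun v => if v = x then a else 2 * k - 2)
      (fun v => k + if v = x then n else 0) hE ?_ ?_ ?_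
    · rw [Finset.sum_add_distrib, Finset.sum_ite_eq' X x, if_pos hx, Finset.sum_const,
        smul_eq_mul, mul_comm] at this
      omega
    · intro v hv e he
      by_cases hvx : v = x
      · subst hvx
        simpa using (hEd e he).1
      · have := (hEd e he).2 v hv hvx
        simp only [hvx, if_false]
        omega
    · intro v hv
      by_cases hvx : v = x
      · subst hvx
        simpa using hn
      · simpa [hvx] using hbase v hv
    · intro v hv w hw hvw
      rw [hX v hv w hw hvw]
      split_ifs with h1 h2 h2
      · exact absurd (h1.trans h2.symm) hvw
      all_goals omega
  have htri : ∀ x ∈ X, ∀ y ∈ X, x ≠ y → ∀ u v, 4 * k + 1 ≤ G.dist x u + G.dist u v + G.dist y v := by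
    intro x hx y hy hxy u v
    have := hX x hx y hy hxy
    have := hG.dist_triangle (u := x) (v := u) (w := y)
    have := hG.dist_triangle (u := u) (v := v) (w := y)
    have := G.dist_comm (u := v) (v := y)
    omega
  have hstrip : ∀ x ∈ X, IsStrip (G.induce {v | G.dist x v ≤ 2 * k}) (2 * k)
        (fun i => {w | G.dist x w = i}) := by
    intro x hx
    obtain ⟨y, hy, hyx⟩ := hother x hx
    have hxy := hX x hx y hy hyx.symm
    refine hG.isStrip_induce_ball (z := y) (by omega) ?_
    intro u v huv hv hl
    by_contra hadj
    rcases Nat.even_or_odd (2 * k - G.dist x v) with hpar | hpar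
    · have := hbound x hx 2 (2 * k) ∅ (by simp) (by simp) le_rfl (by
        have := hG.hasPacking_of_not_adj (z := y) (r := 2 * k) (by omega) huv hadj hl hv hpar
        convert this using 1
        omega)
      simp at this
    · obtain ⟨c, hc⟩ := hpar
      -- With radius `2k - 1` the missing edge gains only one vertex; `w`, at distance `2k + 1` from
      -- `x` and at least `2k` from every other centre, is the second.
      obtain ⟨w, hw, hwy⟩ := hG.exists_dist_eq_of_le (x := x) (y := y) (i := 2 * k + 1) (by omega)
      have := hbound x hx 1 (2 * k - 1) {w} (by simp) (by
          simp only [Finset.mem_singleton, forall_eq]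
          refine ⟨by omega, fun z hz hzx => ?_⟩
          by_cases hzy : z = y
          · subst hzy
            rw [dist_comm]
            omega
          · have := htri z hz y hy hzy w w
            rw [dist_self, dist_comm (u := y), hwy] at this
            omega) (by omega) (by
        have := hG.hasPacking_of_not_adj (z := y) (r := 2 * k - 1) (by omega) huv hadj hl
          (by omega) ⟨c, by omega⟩
        convert this using 1
        omega)
      simp at this
  have hhub : ∀ u v, u ≠ v → (∀ x ∈ X, 2 * k ≤ G.dist x u) → (∀ x ∈ X, 2 * k ≤ G.dist x v) →
      G.Adj u v := by
    intro u v huv hu hv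
    by_contra hadj
    obtain ⟨x, hx⟩ : X.Nonempty := Finset.card_pos.1 (by omega)
    have := hbound x hx 0 (2 * k - 2) {u, v} (by
        rw [Finset.coe_pair, isIndepSet_iff, Set.pairwise_pair]
        exact fun _ => ⟨hadj, fun h => hadj h.symm⟩) (by
        have := hu x hx
        have := hv x hx
        simp only [Finset.mem_insert, Finset.mem_singleton]
        rintro e (rfl | rfl)
        · exact ⟨by omega, fun y hy _ => hu y hy⟩
        · exact ⟨by omega, fun y hy _ => hv y hy⟩) (by omega) (hbase x hx)
    rw [Finset.card_pair huv] at this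
    omega
  set e := X.equivFin.symm with he
  have hinj : ∀ i j, i ≠ j → (e i : V) ≠ e j := fun i j hij h =>
    hij (e.injective (Subtype.ext h))
  -- The hub consists of the vertices at distance at least `2k` from all centres.
  have hmem : ∀ v, (v ∈ (⋃ i, {v | G.dist (e i) v ≤ 2 * k})ᶜ ∪ ⋃ i, Subtype.val ''
      ({w | G.dist (e i) w = 2 * k} : Set {v | G.dist (e i) v ≤ 2 * k})) ↔
      ∀ x ∈ X, 2 * k ≤ G.dist x v := by
    intro v
    simp only [Set.mem_union, Set.mem_compl_iff, Set.mem_iUnion, Set.mem_ofPred_eq, Set.mem_image,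
      not_exists, not_le]
    constructor
    · rintro (h | ⟨i, w, hw, rfl⟩) x hx
      · have := h (X.equivFin ⟨x, hx⟩)
        simp [he] at this
        omega
      · by_cases hxi : x = e i
        · rw [hxi, hw]
        · have := htri x hx (e i) (e i).2 hxi w w
          rw [dist_self, hw] at this
          omega
    · intro h
      by_cases h' : ∃ i, G.dist (e i) v ≤ 2 * k
      · obtain ⟨i, hi⟩ := h'
        exact Or.inr ⟨i, ⟨v, hi⟩, le_antisymm hi (h _ (e i).2), rfl⟩
      · push Not at h'
        exact Or.inl h'
  refine ⟨fun i => {v | G.dist (e i) v ≤ 2 * k}, fun i j => {w | G.dist (e i) w = j}, _, _, ?_,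
    rfl, rfl, fun i => hstrip _ (e i).2, ?_, ?_⟩
  · intro i j hij
    rw [Set.disjoint_left]
    intro v hv hv'
    have := htri (e i) (e i).2 (e j) (e j).2 (hinj i j hij) v v
    simp at this hv hv'
    omega
  · intro u hu v hv huv
    exact hhub u v huv ((hmem u).1 hu) ((hmem v).1 hv)
  · intro u v huv
    by_contra! h
    have hd := dist_eq_one_iff_adj.2 huv
    have hlow : ∀ u v, G.dist u v = 1 → (∀ i, G.dist (e i) u ≤ 2 * k → ¬ G.dist (e i) v ≤ 2 * k) →
        ∀ x ∈ X, 2 * k ≤ G.dist x u := by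
      intro u v hd h x hx
      have := h (X.equivFin ⟨x, hx⟩)
      simp [he] at this
      have := hG.dist_triangle (u := x) (v := u) (w := v)
      omega
    refine h.2 ((hmem u).2 (hlow u v hd h.1)) ((hmem v).2 (hlow v u ?_ fun i hi hi' => ?_))
    · rw [dist_comm, hd]
    · exact h.1 i hi' hi

end Extremal

/-! ### Both families attain the bound. -/

section Converse

/-- Depth grows by at most 1 along an edge, and layers `2j` and `2j + 1` together form a clique. The
former will bound distances, the latter `α`. -/
theorem IsStrip.exists_root_depth {W : Type*} {H : SimpleGraph W} {k : ℕ} {B : Fin (k + 1) → Set W}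
    (hB : IsStrip H k B) : ∃ (x : W) (d : W → ℕ), d x = 0 ∧ (∀ w, d w ≤ k) ∧
      (∀ i w, w ∈ B i ↔ d w = i) ∧ (∀ u v, H.Adj u v → d v ≤ d u + 1) ∧
      ∀ u v, u ≠ v → d u / 2 = d v / 2 → H.Adj u v := by
  obtain ⟨x, hx, hd⟩ := hB.dist_root
  have hmem : ∀ i w, w ∈ B i ↔ H.dist x w = i := by
    intro i w
    refine ⟨hd i w, fun h => ?_⟩
    obtain ⟨j, hj, -⟩ := hB.partition w
    have : i = j := Fin.ext (h.symm.trans (hd j w hj))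
    rwa [this]
  have hle : ∀ w, H.dist x w ≤ k := by
    intro w
    obtain ⟨j, hj, -⟩ := hB.partition w
    rw [hd j w hj]
    omega
  have hreach : ∀ w, H.Reachable x w := by
    intro w
    -- `dist` is also 0 for unreachable pairs; that `B 0` is a singleton excludes this.
    by_cases hw : H.dist x w = 0
    · have : w ∈ B 0 := (hmem 0 w).2 (by simpa using hw)
      rw [hx] at this
      rw [this]
    · exact Reachable.of_dist_ne_zero hw
  have hjoin : ∀ u v, Even (H.dist x u) → H.dist x v = H.dist x u + 1 → H.Adj u v := by
    intro u v he huv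
    have := hle v
    exact hB.joined ⟨H.dist x u, by omega⟩ ⟨H.dist x v, by omega⟩ he huv u ((hmem _ u).2 rfl) v
      ((hmem _ v).2 rfl)
  refine ⟨x, H.dist x, dist_self, hle, hmem, fun u v huv => ?_, fun u v huv hdiv => ?_⟩
  · have := (hreach u).dist_triangle_left v
    rwa [dist_eq_one_iff_adj.2 huv] at this
  · rcases Nat.lt_trichotomy (H.dist x u) (H.dist x v) with h | h | h
    · exact hjoin u v (Nat.even_iff.2 (by omega)) (by omega)
    · have := hle v
      exact hB.isClique ⟨H.dist x v, by omega⟩ ((hmem _ u).2 h) ((hmem _ v).2 rfl) huv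
    · exact (hjoin v u (Nat.even_iff.2 (by omega)) (by omega)).symm

variable {V : Type*} {G : SimpleGraph V}

theorem Connected.le_add_dist_of_adj (hG : G.Connected) {φ : V → ℕ}
    (hφ : ∀ u v, G.Adj u v → φ v ≤ φ u + 1) (u v : V) : φ v ≤ φ u + G.dist u v := by
  obtain ⟨p, hp⟩ := hG.exists_walk_length_eq_dist u v
  rw [← hp]
  clear hp
  induction p with
  | nil => simp
  | cons h p ih =>
    have := hφ _ _ h
    rw [Walk.length_cons]
    omega

theorem indepNum_le_card_of_cliques [Finite V] {C : Type*} [Fintype C] (c : V → C)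
    (hc : ∀ u v, u ≠ v → c u = c v → G.Adj u v) : G.indepNum ≤ Fintype.card C := by
  obtain ⟨T, hT⟩ := G.exists_isNIndepSet_indepNum
  rw [← hT.card_eq, ← Finset.card_univ]
  refine Finset.card_le_card_of_injOn c (fun _ _ => Finset.mem_univ _) fun u hu v hv huv => ?_
  by_contra hne
  exact hT.isIndepSet hu hv hne (hc u v hne huv)

variable [Fintype V]

theorem Connected.sum_le_broadcastIndepNum (hG : G.Connected) {f : V → ℕ}
    (hf : IsIndependentBroadcast G f) : ∑ x, f x ≤ broadcastIndepNum G := by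
  -- `sSup` on `ℕ` requires boundedness: each value is at most an eccentricity, hence below `2α`.
  refine le_csSup ⟨∑ _ : V, 2 * G.indepNum, ?_⟩ ⟨f, hf, rfl⟩
  rintro _ ⟨g, hg, rfl⟩
  refine Finset.sum_le_sum fun x _ => ?_
  obtain ⟨z, hz⟩ := hG.exists_le_dist_of_le_eccent (hg.le_eccent x)
  have := hG.dist_add_one_le_two_mul_indepNum x z
  omega

theorem Connected.card_mul_le_broadcastIndepNum (hG : G.Connected) {X : Finset V} {m : ℕ}
    (hcard : 2 ≤ X.card) (hX : ∀ x ∈ X, ∀ y ∈ X, x ≠ y → m < G.dist x y) :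
    X.card * m ≤ broadcastIndepNum G := by
  classical
  have := hG.sum_le_broadcastIndepNum (f := fun x => if x ∈ X then m else 0) ⟨?_, ?_⟩
  · simpa using this
  · intro x
    split_ifs with hx
    · obtain ⟨y, hy, hyx⟩ := Finset.exists_mem_ne hcard x
      exact natCast_le_eccent_of_le_dist (hX x hx y hy hyx.symm).le
    · simp
  · intro x y hxy hx hy
    have hx' : x ∈ X := by by_contra h; simp [h] at hx
    have hy' : y ∈ X := by by_contra h; simp [h] at hy
    simpa [hx', hy'] using hX x hx' y hy' hxy

theorem IsGluedPair.four_mul_indepNum_le {k : ℕ} (h : IsGluedPair G k) :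
    4 * G.indepNum ≤ broadcastIndepNum G + 4 := by
  classical
  obtain ⟨hG, S₁, S₂, B₁, B₂, hS, h₁, h₂, hE⟩ := h
  obtain ⟨x₁, d₁, hx₁, hle₁, hmem₁, hlip₁, hcl₁⟩ := IsStrip.exists_root_depth h₁
  obtain ⟨x₂, d₂, hx₂, hle₂, hmem₂, hlip₂, hcl₂⟩ := IsStrip.exists_root_depth h₂
  have hcov : ∀ v, v ∈ S₁ ∨ v ∈ S₂ := fun v => by
    have : v ∈ S₁ ⊔ S₂ := by rw [hS.sup_eq_top]; trivial
    exact this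
  have hdisj : ∀ v, v ∈ S₁ → v ∉ S₂ := fun v h => Set.disjoint_left.1 hS.disjoint h
  have hE' : ∀ (u : S₁) (v : S₂), G.Adj u v → d₁ u = 2 * k + 1 ∧ d₂ v = 2 * k + 1 := by
    intro u v huv
    have := hE u v huv
    rw [hmem₁, hmem₂] at this
    exact this
  have hα : G.indepNum ≤ 2 * k + 2 := by
    have : ∀ v, ∃ c : Fin (k + 1) ⊕ Fin (k + 1),
        (∀ t, c = Sum.inl t → ∃ h : v ∈ S₁, d₁ ⟨v, h⟩ / 2 = t) ∧
        (∀ t, c = Sum.inr t → ∃ h : v ∈ S₂, d₂ ⟨v, h⟩ / 2 = t) := by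
      intro v
      rcases hcov v with h | h
      · have := hle₁ ⟨v, h⟩
        refine ⟨Sum.inl ⟨d₁ ⟨v, h⟩ / 2, by omega⟩, ?_, by simp⟩
        rintro _ ⟨⟩
        exact ⟨h, rfl⟩
      · have := hle₂ ⟨v, h⟩
        refine ⟨Sum.inr ⟨d₂ ⟨v, h⟩ / 2, by omega⟩, by simp, ?_⟩
        rintro _ ⟨⟩
        exact ⟨h, rfl⟩
    choose c hc₁ hc₂ using this
    have := indepNum_le_card_of_cliques (G := G) c (fun u v huv hc => by
      rcases hcu : c u with t | t
      · obtain ⟨hu, hut⟩ := hc₁ u t hcu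
        obtain ⟨hv, hvt⟩ := hc₁ v t (hc ▸ hcu)
        exact hcl₁ ⟨u, hu⟩ ⟨v, hv⟩ (fun h => huv (congrArg Subtype.val h)) (hut.trans hvt.symm)
      · obtain ⟨hu, hut⟩ := hc₂ u t hcu
        obtain ⟨hv, hvt⟩ := hc₂ v t (hc ▸ hcu)
        exact hcl₂ ⟨u, hu⟩ ⟨v, hv⟩ (fun h => huv (congrArg Subtype.val h)) (hut.trans hvt.symm))
    simp at this
    omega
  have hdist : 4 * k + 2 < G.dist x₁ x₂ := by
    -- A potential rising by at most 1 along each edge, from 0 at `x₁` to `4k + 3` at `x₂`; it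
    -- passes from `2k + 1` to `2k + 2` between the strips.
    have : ∀ v, ∃ n, (∀ h : v ∈ S₁, n = d₁ ⟨v, h⟩) ∧
        (∀ h : v ∈ S₂, n = 4 * k + 3 - d₂ ⟨v, h⟩) := by
      intro v
      rcases hcov v with h | h
      · exact ⟨d₁ ⟨v, h⟩, fun _ => rfl, fun h' => absurd h' (hdisj v h)⟩
      · exact ⟨4 * k + 3 - d₂ ⟨v, h⟩, fun h' => absurd h (hdisj v h'), fun _ => rfl⟩
    choose φ hφ₁ hφ₂ using this
    have := hG.le_add_dist_of_adj (φ := φ) (fun u v huv => by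
      rcases hcov u with hu | hu <;> rcases hcov v with hv | hv
      · have := hlip₁ ⟨u, hu⟩ ⟨v, hv⟩ huv
        rw [hφ₁ u hu, hφ₁ v hv]
        omega
      · have := hE' ⟨u, hu⟩ ⟨v, hv⟩ huv
        rw [hφ₁ u hu, hφ₂ v hv]
        omega
      · have := hE' ⟨v, hv⟩ ⟨u, hu⟩ huv.symm
        rw [hφ₂ u hu, hφ₁ v hv]
        omega
      · have := hlip₂ ⟨v, hv⟩ ⟨u, hu⟩ huv.symm
        rw [hφ₂ u hu, hφ₂ v hv]
        omega) x₁ x₂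
    rw [hφ₁ _ x₁.2, hφ₂ _ x₂.2, hx₁, hx₂] at this
    omega
  have hne : (x₁ : V) ≠ x₂ := by
    intro h
    rw [h, dist_self] at hdist
    omega
  have := hG.card_mul_le_broadcastIndepNum (X := {(x₁ : V), (x₂ : V)}) (m := 4 * k + 2)
    (by rw [Finset.card_pair hne]) (by
      simp only [Finset.mem_insert, Finset.mem_singleton]
      rintro v (rfl | rfl) w (rfl | rfl) hvw
      · exact absurd rfl hvw
      · exact hdist
      · rwa [dist_comm]
      · exact absurd rfl hvw)
  rw [Finset.card_pair hne] at this
  omega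

theorem IsGluedStar.four_mul_indepNum_le (hG : G.Connected) {k ℓ : ℕ}
    (hℓ : 2 ≤ ℓ) (h : IsGluedStar G k ℓ) : 4 * G.indepNum ≤ broadcastIndepNum G + 4 := by
  classical
  obtain ⟨S, B, R, hub, hdisj, hR, hhub, hB, hcl, hE⟩ := h
  choose x d hx hle hmem hlip hdcl using fun i => IsStrip.exists_root_depth (hB i)
  have hdisj' : ∀ {i j v}, v ∈ S i → v ∈ S j → i = j := by
    intro i j v hi hj
    by_contra hij
    exact Set.disjoint_left.1 (hdisj hij) hi hj
  have hub_of_not_mem : ∀ v, (∀ i, v ∉ S i) → v ∈ hub := by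
    intro v hv
    rw [hhub, hR]
    exact Or.inl (by simpa using hv)
  have mem_hub : ∀ i (v : S i), (v : V) ∈ hub ↔ d i v = 2 * k := by
    intro i v
    rw [hhub, hR]
    constructor
    · rintro (h | h)
      · exact absurd (Set.mem_iUnion.2 ⟨i, v.2⟩) h
      · obtain ⟨j, w, hw, hwv⟩ := Set.mem_iUnion.1 h
        obtain rfl : j = i := hdisj' (hwv ▸ w.2) v.2
        obtain rfl : w = v := Subtype.ext hwv
        exact (hmem j _ w).1 hw
    · intro h
      exact Or.inr (Set.mem_iUnion.2 ⟨i, v, (hmem i _ v).2 h, rfl⟩)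
  have hα : G.indepNum ≤ ℓ * k + 1 := by
    -- The clique cover: the hub, and `k` pairs of layers below depth `2k` in each strip.
    have : ∀ v, ∃ c : Option (Fin ℓ × Fin k), (c = none → v ∈ hub) ∧
        ∀ i t, c = some (i, t) → ∃ h : v ∈ S i, d i ⟨v, h⟩ / 2 = t := by
      intro v
      by_cases hv : v ∈ hub
      · exact ⟨none, fun _ => hv, by simp⟩
      · obtain ⟨i, hi⟩ : ∃ i, v ∈ S i := by
          by_contra! h
          exact hv (hub_of_not_mem v h)
        have h1 := hle i ⟨v, hi⟩
        have h2 := mt (mem_hub i ⟨v, hi⟩).2 hv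
        refine ⟨some (i, ⟨d i ⟨v, hi⟩ / 2, by omega⟩), by simp, ?_⟩
        rintro _ _ ⟨⟩
        exact ⟨hi, rfl⟩
    choose c hc₁ hc₂ using this
    have := indepNum_le_card_of_cliques (G := G) c (fun u v huv hc => by
      rcases hcu : c u with _ | ⟨i, t⟩
      · exact hcl (hc₁ u hcu) (hc₁ v (hc ▸ hcu)) huv
      · obtain ⟨hu, hut⟩ := hc₂ u i t hcu
        obtain ⟨hv, hvt⟩ := hc₂ v i t (hc ▸ hcu)
        exact hdcl i ⟨u, hu⟩ ⟨v, hv⟩ (fun h => huv (congrArg Subtype.val h)) (hut.trans hvt.symm))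
    simpa using this
  have hdist : ∀ i j, i ≠ j → 4 * k < G.dist (x i) (x j) := by
    intro i j hij
    -- A potential from 0 at `x i` to `4k + 1` at `x j`, taking only the values `2k` and `2k + 1` on
    -- the hub.
    have : ∀ v, ∃ n, (∀ h : v ∈ S i, n = d i ⟨v, h⟩) ∧
        (∀ h : v ∈ S j, n = 4 * k + 1 - d j ⟨v, h⟩) ∧ (v ∉ S i → v ∉ S j → n = 2 * k) := by
      intro v
      by_cases hi : v ∈ S i
      · exact ⟨d i ⟨v, hi⟩, fun _ => rfl, fun h' => absurd (hdisj' hi h') hij,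
          fun h' => absurd hi h'⟩
      · by_cases hj : v ∈ S j
        · exact ⟨4 * k + 1 - d j ⟨v, hj⟩, fun h' => absurd h' hi, fun _ => rfl,
            fun _ h' => absurd hj h'⟩
        · exact ⟨2 * k, fun h' => absurd h' hi, fun h' => absurd h' hj, fun _ _ => rfl⟩
    choose φ hφ₁ hφ₂ hφ₃ using this
    have hφhub : ∀ v ∈ hub, 2 * k ≤ φ v ∧ φ v ≤ 2 * k + 1 := by
      intro v hv
      by_cases hi : v ∈ S i
      · rw [hφ₁ v hi, (mem_hub i ⟨v, hi⟩).1 hv]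
        omega
      · by_cases hj : v ∈ S j
        · rw [hφ₂ v hj, (mem_hub j ⟨v, hj⟩).1 hv]
          omega
        · rw [hφ₃ v hi hj]
          omega
    have := hG.le_add_dist_of_adj (φ := φ) (fun u v huv => by
      rcases hE u v huv with ⟨m, hu, hv⟩ | ⟨hu, hv⟩
      · by_cases hmi : m = i
        · subst hmi
          rw [hφ₁ u hu, hφ₁ v hv]
          exact hlip m ⟨u, hu⟩ ⟨v, hv⟩ huv
        · by_cases hmj : m = j
          · subst hmj
            have := hlip m ⟨v, hv⟩ ⟨u, hu⟩ huv.symm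
            rw [hφ₂ u hu, hφ₂ v hv]
            omega
          · rw [hφ₃ u (fun h => hmi (hdisj' hu h)) (fun h => hmj (hdisj' hu h)),
              hφ₃ v (fun h => hmi (hdisj' hv h)) (fun h => hmj (hdisj' hv h))]
            omega
      · have := hφhub u hu
        have := hφhub v hv
        omega) (x i) (x j)
    rw [hφ₁ _ (x i).2, hφ₂ _ (x j).2, hx, hx] at this
    omega
  have hinj : Function.Injective fun i => (x i : V) := by
    intro i j hij
    exact hdisj' (x i).2 (by have h : (x i : V) = x j := hij; rw [h]; exact (x j).2)
  have hcard : (Finset.univ.image fun i => (x i : V)).card = ℓ := by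
    rw [Finset.card_image_of_injective _ hinj, Finset.card_univ, Fintype.card_fin]
  have := hG.card_mul_le_broadcastIndepNum (X := Finset.univ.image fun i => (x i : V))
    (m := 4 * k) (by rw [hcard]; exact hℓ) (by
      simp only [Finset.mem_image, Finset.mem_univ, true_and]
      rintro _ ⟨i, rfl⟩ _ ⟨j, rfl⟩ hij
      exact hdist i j fun h => hij (by rw [h]))
  rw [hcard] at this
  have e : ℓ * (4 * k) = 4 * (ℓ * k) := by ring
  omega

end Converse

/-! ### From equality to the two families. -/

section Characterization

variable {V : Type*} [Fintype V] {G : SimpleGraph V}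

theorem Connected.memG0_or_memG2_of_sum_eq (hG : G.Connected) {f : V → ℕ}
    (hf : IsIndependentBroadcast G f) {X : Finset V} (hX : ∀ x ∈ X, 0 < f x) (hcard : 2 ≤ X.card)
    (hsum : ∑ x ∈ X, f x + 4 = 4 * G.indepNum) : MemG0 G ∨ MemG2 G := by
  classical
  rcases (hG.sum_add_four_le_of_isIndependentBroadcast hf X hX hcard).2 hsum with
    h0 | ⟨h2, hmod⟩
  · left
    have hpair : ∀ x ∈ X, ∀ y ∈ X, x ≠ y → f y = f x ∧ G.dist x y = f x + 1 := by
      intro x hx y hy hxy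
      have hd := hf.lt_dist x y hxy (hX x hx) (hX y hy)
      have h1 := le_max_left (f x) (f y)
      have h2 := le_max_right (f x) (f y)
      have hx0 := h0 x hx
      have hy0 := h0 y hy
      have hxp := hX x hx
      have hyp := hX y hy
      -- As `dist x y` exceeds both values and these are multiples of 4, this bound forces them to
      -- be equal. Otherwise the packings at `x` and `y` could both be enlarged, one vertex more
      -- than equality permits.
      suffices G.dist x y < f x / 2 + f y / 2 + 2 by omega
      by_contra! hfar
      have key := hG.sum_div_add_le_of_isIndependentBroadcast hf (fun v => v = x ∨ v = y) (by
          rintro v w (rfl | rfl) (rfl | rfl) hvw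
          · exact absurd rfl hvw
          · omega
          · rw [dist_comm]
            omega
          · exact absurd rfl hvw) (by
          rintro v (rfl | rfl)
          · exact Or.inl hx0
          · exact Or.inl hy0) X hX
      rw [Finset.sum_add_distrib, ← Finset.card_filter] at key
      have h3 : 2 ≤ (X.filter fun v => v = x ∨ v = y).card := by
        rw [← Finset.card_pair hxy]
        apply Finset.card_le_card
        intro v
        simp only [Finset.mem_insert, Finset.mem_singleton, Finset.mem_filter]
        rintro (rfl | rfl) <;> simp [*]
      have h4 : ∑ v ∈ X, f v ≤ ∑ v ∈ X, 4 * ((f v - 1) / 4 + 1) :=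
        Finset.sum_le_sum fun v hv => by omega
      rw [← Finset.mul_sum] at h4
      omega
    obtain ⟨x₀, hx₀⟩ : X.Nonempty := Finset.card_pos.1 (by omega)
    have hconst : ∀ x ∈ X, f x = 4 * (f x₀ / 4) := by
      intro x hx
      have := h0 x₀ hx₀
      by_cases h : x₀ = x
      · subst h
        omega
      · have := (hpair x₀ hx₀ x hx h).1
        omega
    refine ⟨f x₀ / 4, X.card, ?_, hcard, ?_⟩
    · have := hconst x₀ hx₀
      have := hX x₀ hx₀
      omega
    · refine hG.isGluedStar_of_dist_eq ?_ hcard (fun x hx y hy hxy => ?_) ?_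
      · have := hconst x₀ hx₀
        have := hX x₀ hx₀
        omega
      · rw [(hpair x hx y hy hxy).2, hconst x hx]
      · rw [Finset.sum_congr rfl hconst, Finset.sum_const, smul_eq_mul] at hsum
        have e : X.card * (4 * (f x₀ / 4)) = 4 * (f x₀ / 4 * X.card) := by ring
        omega
  · right
    obtain ⟨x, y, hxy, rfl⟩ := Finset.card_eq_two.1 h2
    rw [Finset.sum_pair hxy] at hsum
    have hx := hmod x (by simp)
    have hd := hf.lt_dist x y hxy (hX x (by simp)) (hX y (by simp))
    have h1 := le_max_left (f x) (f y)
    have h2 := le_max_right (f x) (f y)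
    have h3 := hG.dist_add_one_le_two_mul_indepNum x y
    exact ⟨f x / 4, hG.isGluedPair_of_dist_eq (x := x) (y := y) (by omega) (by omega)⟩

end Characterization

end SimpleGraph

open SimpleGraph in
theorem theorem1 {V : Type*} [Fintype V] (G : SimpleGraph V) (hG : G.Connected)
    (h : 3 ≤ G.diam ∨ 3 ≤ G.indepNum) (f : V → ℕ) (hf : IsOptimalBroadcast G f) :
    (broadcastIndepNum G : ℝ) ≤ 4 * (G.indepNum : ℝ)
        - 4 * min 1 (2 * (G.indepNum : ℝ) / (((Finset.univ.sup f : ℕ) : ℝ) + 2)) ∧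
    broadcastIndepNum G ≤ 4 * G.indepNum ∧
    ((broadcastIndepNum G : ℝ) = 4 * (G.indepNum : ℝ)
        - 4 * min 1 (2 * (G.indepNum : ℝ) / (((Finset.univ.sup f : ℕ) : ℝ) + 2)) ↔
      MemG0 G ∨ MemG2 G) := by
  classical
  obtain ⟨hf, hopt⟩ := hf
  have := hG.nonempty
  have hα : 2 ≤ G.indepNum := by
    rcases h with h | h
    · obtain ⟨u, v, huv⟩ := G.exists_dist_eq_diam
      have := hG.dist_add_one_le_two_mul_indepNum u v
      omega
    · omega
  have hconv : MemG0 G ∨ MemG2 G → 4 * G.indepNum ≤ broadcastIndepNum G + 4 := by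
    rintro (⟨k, ℓ, -, hℓ, h⟩ | ⟨k, h⟩)
    · exact IsGluedStar.four_mul_indepNum_le hG hℓ h
    · exact IsGluedPair.four_mul_indepNum_le h
  set X := Finset.univ.filter fun x => 0 < f x with hXdef
  have hX : ∀ x ∈ X, 0 < f x := fun x hx => (Finset.mem_filter.1 hx).2
  have hsum : ∑ x ∈ X, f x = broadcastIndepNum G := by
    rw [← hopt]
    refine Finset.sum_subset (Finset.subset_univ _) fun x _ hx => ?_
    simpa [hXdef] using hx
  have hecc : ∀ x, f x + 1 ≤ 2 * G.indepNum := fun x => by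
    obtain ⟨z, hz⟩ := hG.exists_le_dist_of_le_eccent (hf.le_eccent x)
    have := hG.dist_add_one_le_two_mul_indepNum x z
    omega
  set M := Finset.univ.sup f with hM
  set a := G.indepNum with ha
  set b := broadcastIndepNum G with hb
  by_cases hcard : 2 ≤ X.card
  · have hM2 : M + 2 ≤ 2 * a := by
      have : M ≤ 2 * a - 2 := Finset.sup_le fun v _ => by
        by_cases hv : v ∈ X
        · obtain ⟨y, hy, hyv⟩ := Finset.exists_mem_ne hcard v
          have hd := hf.lt_dist v y hyv.symm (hX v hv) (hX y hy)
          have h1 := le_max_left (f v) (f y)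
          have := hG.dist_add_one_le_two_mul_indepNum v y
          omega
        · have : f v = 0 := by simpa [hXdef] using hv
          omega
      omega
    have hmin : min 1 (2 * (a : ℝ) / ((M : ℝ) + 2)) = 1 := by
      apply min_eq_left
      rw [one_le_div (by positivity)]
      exact_mod_cast hM2
    have hmain := (hG.sum_add_four_le_of_isIndependentBroadcast hf X hX hcard).1
    rw [hsum, ← ha] at hmain
    have hreal : (b : ℝ) + 4 ≤ 4 * a := by exact_mod_cast hmain
    rw [hmin]
    refine ⟨by linarith, by omega, fun heq => ?_, fun hmem => ?_⟩
    · refine hG.memG0_or_memG2_of_sum_eq hf hX hcard ?_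
      rw [hsum, ← ha]
      have : (b : ℝ) + 4 = 4 * a := by linarith
      exact_mod_cast this
    · have : (4 : ℝ) * a ≤ b + 4 := by exact_mod_cast hconv hmem
      linarith
  · have hbM : b ≤ M := by
      rw [← hsum]
      rcases Nat.lt_or_ge X.card 1 with h0 | h1
      · rw [Finset.card_eq_zero.1 (show X.card = 0 by omega)]
        simp
      · obtain ⟨x, hx⟩ := Finset.card_eq_one.1 (show X.card = 1 by omega)
        rw [hx, Finset.sum_singleton]
        exact Finset.le_sup (Finset.mem_univ x)
    have hMa : M + 1 ≤ 2 * a := by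
      have : M ≤ 2 * a - 1 := Finset.sup_le fun v _ => by have := hecc v; omega
      omega
    have hstrict : (b : ℝ) < 4 * a - 4 * min 1 (2 * (a : ℝ) / ((M : ℝ) + 2)) := by
      have hα' : (2 : ℝ) ≤ a := by exact_mod_cast hα
      have hbM' : (b : ℝ) ≤ M := by exact_mod_cast hbM
      -- Only for `M = 2a - 1` is the minimum below 1; for smaller `M`, already `M ≤ 2a - 2 < 4a -
      -- 4` because `a ≥ 2`.
      rcases Nat.lt_or_ge (M + 1) (2 * a) with hlt | hge
      · have h1 := min_le_left 1 (2 * (a : ℝ) / ((M : ℝ) + 2))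
        have h2 : (M : ℝ) + 2 ≤ 2 * a := by exact_mod_cast hlt
        linarith
      · have h1 := min_le_right 1 (2 * (a : ℝ) / ((M : ℝ) + 2))
        have h2 : (M : ℝ) + 1 = 2 * a := by exact_mod_cast le_antisymm hMa hge
        have h3 : 2 * (a : ℝ) / ((M : ℝ) + 2) < 1 := by
          rw [div_lt_one (by positivity)]
          linarith
        linarith
    refine ⟨hstrict.le, by omega, fun heq => absurd heq hstrict.ne, fun hmem => ?_⟩
    have := hconv hmem
    omega
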